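/- Let $X$ be a (real or complex) Banach space, let $Q$ be a nonempty index set, and for each $q\in Q$ let $A_q$ be the infinitesimal generator of a $C_0$-semigroup $T_q$ of bounded linear operators on $X$. Let $\mathcal D$ be the set of all piecewise constant $d:\mathbb R_+\to Q$, i.e. such that every bounded interval $[s,t)\subset\mathbb R_+$ can be partitioned into finitely many half-open intervals $[a_i,b_i)$ on each of which $d$ is constant. For $d\in\mathcal D$ and $s=b_0<b_1<\dots<b_k=t$ with $d\equiv d_j$ on $[b_{j-1},b_j)$ put $$\Phi_d(t,s)=T_{d_k}(t-b_{k-1})\,T_{d_{k-1}}(b_{k-1}-b_{k-2})\cdots T_{d_1}(b_1-s)$$ (with $\Phi_d(s,s)=I$; the choice of partition is immaterial), and let $\phi(t,x,d)=\Phi_d(t,0)x$ for $t\ge 0$, $x\in X$, $d\in\mathcal D$. This is the switched linear system $\Sigma=(X,\mathcal D,\phi)$ given by $\dot x=A_{d(t)}x$. Let $\mathcal K$ be the set of continuous strictly increasing $\gamma:\mathbb R_+\to\mathbb R_+$ with $\gamma(0)=0$, $\mathcal K_\infty$ the set of unbounded $\gamma\in\mathcal K$, and $\mathcal{KL}$ the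 set of $\beta:\mathbb R_+^2\to\mathbb R_+$ such that $\beta(\cdot,t)\in\mathcal K$ for all $t\ge0$ and, for all $r>0$, $\beta(r,\cdot)$ is continuous and decreasing with limit $0$ at infinity. A non-coercive Lyapunov function for $\Sigma$ is a continuous $V:X\to\mathbb R_+$ with $V(0)=0$ for which there are $\psi_2\in\mathcal K_\infty$ and $\alpha\in\mathcal K$ such that $0<V(x)\le\psi_2(\|x\|)$ for all $x\ne0$ and $\liminf_{t\to0+}\frac1t\bigl(V(\phi(t,x,d))-V(x)\bigr)\le-\alpha(\|x\|)$ for all $x\in X$, $d\in\mathcal D$. The system $\Sigma$ is robustly forward complete (RFC) if for all $C>0$, $\tau>0$ one has $\sup\{\|\phi(t,x,d)\| : \|x\|\le C,\ t\in[0,\tau],\ d\in\mathcal D\}<\infty$. The point $0$ is uniformly globally weakly attractive if for all $\varepsilon,r>0$ there is $\tau\ge 0$ such that for all $x$ with $\|x\|\le r$ and all $d\in\mathcal D$ there is $t\in[0,\tau]$ with $\|\phi(t,x,d)\|\le\varepsilon$; it is uniformly globally asymptotically stable (UGAS) if there is $\beta\in\mathcal{KL}$ with $\|\phi(t,x,d)\|\le\beta(\|x\|,t)$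 for all $x,d$ and $t\ge0$; and it is exponentially stable if there are $M\ge1$, $\omega>0$ with $\|\phi(t,x,d)\|\le Me^{-\omega t}\|x\|$ for all $x,d$ and $t\ge0$. Then: (i) If there exists a non-coercive Lyapunov function for $\Sigma$, then $0$ is uniformly globally weakly attractive. (ii) If $\Sigma$ is RFC, then there exists a non-coercive Lyapunov function for $\Sigma$ if and only if $0$ is UGAS, and $0$ is UGAS if and only if $0$ is exponentially stable. -/

import Mathlib

open Filter Topology
open scoped NNReal

/-! ### Comparison functions -/

/-- Class `𝒦`: continuous, strictly increasing functions `ℝ₊ → ℝ₊` vanishing at `0`. -/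
structure ClassK (γ : ℝ≥0 → ℝ≥0) : Prop where
  continuous : Continuous γ
  strictMono : StrictMono γ
  map_zero : γ 0 = 0

/-- Class `𝒦∞`: unbounded functions of class `𝒦`. -/
structure ClassKInf (γ : ℝ≥0 → ℝ≥0) : Prop extends ClassK γ where
  unbounded : ¬ BddAbove (Set.range γ)

/-- Class `ℒ`: continuous, decreasing functions `ℝ₊ → ℝ₊` tending to `0` at infinity. -/
structure ClassL (γ : ℝ≥0 → ℝ≥0) : Prop where
  continuous : Continuous γ
  antitone : Antitone γ
  tendsto_zero : Tendsto γ atTop (𝓝 0)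

/-- Class `𝒦ℒ`. -/
structure ClassKL (β : ℝ≥0 → ℝ≥0 → ℝ≥0) : Prop where
  classK : ∀ t, ClassK (fun r => β r t)
  classL : ∀ r, 0 < r → ClassL (β r)

/-! ### Notions for a system with transition map `φ(t, x, d)` -/

section Systems

variable {X 𝒟 : Type*} [NormedAddCommGroup X]

/-- Robust forward completeness. -/
def RobustlyForwardComplete (φ : ℝ≥0 → X → 𝒟 → X) : Prop :=
  ∀ C : ℝ, 0 < C → ∀ τ : ℝ≥0, 0 < τ →
    BddAbove {r : ℝ | ∃ (t : ℝ≥0) (x : X) (d : 𝒟), ‖x‖ ≤ C ∧ t ≤ τ ∧ r = ‖φ t x d‖}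

/-- `0` is uniformly globally asymptotically stable. -/
def UGAS (φ : ℝ≥0 → X → 𝒟 → X) : Prop :=
  ∃ β : ℝ≥0 → ℝ≥0 → ℝ≥0, ClassKL β ∧
    ∀ (x : X) (d : 𝒟) (t : ℝ≥0), ‖φ t x d‖ ≤ β ‖x‖₊ t

/-- `0` is uniformly globally weakly attractive. -/
def UniformlyGloballyWeaklyAttractive (φ : ℝ≥0 → X → 𝒟 → X) : Prop :=
  ∀ ε : ℝ, 0 < ε → ∀ r : ℝ, 0 < r → ∃ τ : ℝ≥0,
    ∀ (x : X) (d : 𝒟), ‖x‖ ≤ r → ∃ t : ℝ≥0, t ≤ τ ∧ ‖φ t x d‖ ≤ ε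

/-- `0` is (globally, uniformly in the disturbance) exponentially stable. -/
def ExponentiallyStable (φ : ℝ≥0 → X → 𝒟 → X) : Prop :=
  ∃ M ω : ℝ, 1 ≤ M ∧ 0 < ω ∧
    ∀ (x : X) (d : 𝒟) (t : ℝ≥0), ‖φ t x d‖ ≤ M * Real.exp (-ω * t) * ‖x‖

/-- The right-hand lower Dini derivative of `V` along the trajectory `φ(·, x, d)` at time `0`,
as an extended real number. -/
noncomputable def diniDeriv (φ : ℝ≥0 → X → 𝒟 → X) (V : X → ℝ≥0) (x : X) (d : 𝒟) : EReal :=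
  liminf (fun t : ℝ≥0 => ((((V (φ t x d) : ℝ) - (V x : ℝ)) / (t : ℝ) : ℝ) : EReal))
    (𝓝[>] (0 : ℝ≥0))

/-- `V` is a non-coercive Lyapunov function for the system with transition map `φ`. -/
def IsNonCoerciveLyapunov (φ : ℝ≥0 → X → 𝒟 → X) (V : X → ℝ≥0) : Prop :=
  Continuous V ∧ V 0 = 0 ∧
    (∃ ψ : ℝ≥0 → ℝ≥0, ClassKInf ψ ∧ ∀ x : X, x ≠ 0 → 0 < V x ∧ V x ≤ ψ ‖x‖₊) ∧
    (∃ α : ℝ≥0 → ℝ≥0, ClassK α ∧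
      ∀ (x : X) (d : 𝒟), diniDeriv φ V x d ≤ ((-(α ‖x‖₊ : ℝ) : ℝ) : EReal))

end Systems

/-! ### Strongly continuous semigroups -/

/-- A `C₀`-semigroup of bounded linear operators on `X`. -/
structure C0Semigroup (𝕜 X : Type*) [RCLike 𝕜] [NormedAddCommGroup X] [NormedSpace 𝕜 X] where
  /-- The operators of the semigroup. -/
  op : ℝ≥0 → X →L[𝕜] X
  op_zero : op 0 = 1
  op_add : ∀ s t, op (s + t) = op s * op t
  continuous_orbit : ∀ x : X, Continuous (fun t => op t x)

/-- The (in general unbounded) operator `A` is the infinitesimal generator of `T`: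
`x` lies in the domain of `A` and `A x = y` iff `(T(h) x - x) / h → y` as `h → 0+`. -/
def C0Semigroup.IsGenerator {𝕜 X : Type*} [RCLike 𝕜] [NormedAddCommGroup X] [NormedSpace 𝕜 X]
    (T : C0Semigroup 𝕜 X) (A : X →ₗ.[𝕜] X) : Prop :=
  ∀ x y : X, (x, y) ∈ A.graph ↔
    Tendsto (fun h : ℝ≥0 => (((h : ℝ) : 𝕜)⁻¹) • (T.op h x - x)) (𝓝[>] (0 : ℝ≥0)) (𝓝 y)

/-! ### Switching signals and the switched linear system -/

/-- `s = b 0 < b 1 < ⋯ < b k = t` and `d` is constant on each `[b j, b (j + 1))`, `j < k`. -/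
structure IsSwitchingPartition {Q : Type*} (d : ℝ≥0 → Q) (s t : ℝ≥0) (k : ℕ) (b : ℕ → ℝ≥0) :
    Prop where
  first : b 0 = s
  last : b k = t
  lt : ∀ j < k, b j < b (j + 1)
  const : ∀ j < k, ∀ τ ∈ Set.Ico (b j) (b (j + 1)), d τ = d (b j)

/-- Piecewise constant functions: every bounded half-open interval `[s, t)` splits into finitely
many half-open intervals on each of which `d` is constant (for `s = t` there are none). -/
def IsPiecewiseConstant {Q : Type*} (d : ℝ≥0 → Q) : Prop :=
  ∀ s t : ℝ≥0, s ≤ t → ∃ (k : ℕ) (b : ℕ → ℝ≥0), IsSwitchingPartition d s t k b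

/-- The space of switching signals. -/
def SwitchingSignal (Q : Type*) : Type _ := {d : ℝ≥0 → Q // IsPiecewiseConstant d}

section Switched

variable {𝕜 X Q : Type*} [RCLike 𝕜] [NormedAddCommGroup X] [NormedSpace 𝕜 X]

/-- `T_{d(b (k-1))}(b k - b (k-1)) ⋯ T_{d(b 0)}(b 1 - b 0)`. -/
noncomputable def partitionProduct (T : Q → C0Semigroup 𝕜 X) (d : ℝ≥0 → Q) (b : ℕ → ℝ≥0) :
    ℕ → X →L[𝕜] X
  | 0 => 1
  | k + 1 => (T (d (b k))).op (b (k + 1) - b k) * partitionProduct T d b k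

/-- The evolution operator `Φ_d(t, s)`, computed from some partition of `[s, t]` adapted to `d`;
by `evolution_eq` below the partition does not matter. -/
noncomputable def evolution (T : Q → C0Semigroup 𝕜 X) (d : SwitchingSignal Q) (t s : ℝ≥0)
    (h : s ≤ t) : X →L[𝕜] X :=
  partitionProduct T d.1 (d.2 s t h).choose_spec.choose (d.2 s t h).choose

/-- The transition map `φ(t, x, d) = Φ_d(t, 0) x` of the switched linear system. -/
noncomputable def switchedFlow (T : Q → C0Semigroup 𝕜 X) (t : ℝ≥0) (x : X)
    (d : SwitchingSignal Q) : X :=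
  evolution T d t 0 (zero_le) x

theorem partitionProduct_congr (T : Q → C0Semigroup 𝕜 X) (d : ℝ≥0 → Q) {b c : ℕ → ℝ≥0} (k : ℕ)
    (h : ∀ j ≤ k, b j = c j) : partitionProduct T d b k = partitionProduct T d c k := by
  induction k with
  | zero => rfl
  | succ k ih =>
    simp only [partitionProduct]
    rw [ih (fun j hj => h j (by omega)), h k (by omega), h (k + 1) le_rfl]

theorem IsSwitchingPartition.le {d : ℝ≥0 → Q} {s t : ℝ≥0} {k : ℕ} {b : ℕ → ℝ≥0}
    (hb : IsSwitchingPartition d s t k b) : ∀ j ≤ k, s ≤ b j := by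
  intro j
  induction j with
  | zero => intro _; exact hb.first.ge
  | succ j ih => intro hj; exact (ih (by omega)).trans (hb.lt j (by omega)).le

theorem IsSwitchingPartition.init {d : ℝ≥0 → Q} {s t : ℝ≥0} {k : ℕ} {b : ℕ → ℝ≥0}
    (hb : IsSwitchingPartition d s t (k + 1) b) : IsSwitchingPartition d s (b k) k b :=
  ⟨hb.first, rfl, fun j hj => hb.lt j (by omega), fun j hj => hb.const j (by omega)⟩

theorem IsSwitchingPartition.cut {d : ℝ≥0 → Q} {s t u : ℝ≥0} {k : ℕ} {b : ℕ → ℝ≥0}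
    (hb : IsSwitchingPartition d s t (k + 1) b) (h1 : b k < u) (h2 : u ≤ t) :
    IsSwitchingPartition d s u (k + 1) (Function.update b (k + 1) u) := by
  have key : ∀ j ≤ k, Function.update b (k + 1) u j = b j := fun j hj =>
    Function.update_of_ne (by omega) _ _
  refine ⟨by rw [key 0 (by omega), hb.first], by simp, ?_, ?_⟩
  · intro j hj
    rw [key j (by omega)]
    rcases Nat.lt_succ_iff_lt_or_eq.mp hj with h | rfl
    · rw [key (j + 1) (by omega)]; exact hb.lt j (by omega)
    · simpa using h1
  · intro j hj τ hτ
    rw [key j (by omega)] at hτ ⊢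
    refine hb.const j hj τ ⟨hτ.1, hτ.2.trans_le ?_⟩
    rcases Nat.lt_succ_iff_lt_or_eq.mp hj with h | rfl
    · rw [key (j + 1) (by omega)]
    · simpa [hb.last] using h2

/-- One step of the comparison of two partitions. -/
theorem partitionProduct_step (T : Q → C0Semigroup 𝕜 X) {d : ℝ≥0 → Q} {s t : ℝ≥0} {k l : ℕ}
    {b c : ℕ → ℝ≥0} (hb : IsSwitchingPartition d s t (k + 1) b)
    (hc : IsSwitchingPartition d s t (l + 1) c) (hlt : b k < c l)
    (h : partitionProduct T d (Function.update b (k + 1) (c l)) (k + 1) =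
      partitionProduct T d c l) :
    partitionProduct T d b (k + 1) = partitionProduct T d c (l + 1) := by
  have hct : c l < t := hc.last ▸ hc.lt l (by omega)
  have hbk : Function.update b (k + 1) (c l) k = b k := Function.update_of_ne (by omega) _ _
  have hcong : partitionProduct T d (Function.update b (k + 1) (c l)) k =
      partitionProduct T d b k :=
    partitionProduct_congr T d k fun j hj => Function.update_of_ne (by omega) _ _
  have hd : d (c l) = d (b k) :=
    hb.const k (by omega) (c l) ⟨hlt.le, by rw [hb.last]; exact hct⟩
  have hsum : t - b k = (t - c l) + (c l - b k) :=
    (tsub_add_tsub_cancel hct.le hlt.le).symm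
  rw [partitionProduct, hbk, hcong, Function.update_self] at h
  rw [partitionProduct, partitionProduct, ← h, hb.last, hc.last, hd, hsum, (T _).op_add, mul_assoc]

/-- The product does not depend on the partition. -/
theorem partitionProduct_unique (T : Q → C0Semigroup 𝕜 X) (d : ℝ≥0 → Q) (s : ℝ≥0) (n : ℕ) :
    ∀ (t : ℝ≥0) (k l : ℕ) (b c : ℕ → ℝ≥0), k + l ≤ n → IsSwitchingPartition d s t k b →
      IsSwitchingPartition d s t l c → partitionProduct T d b k = partitionProduct T d c l := by
  induction n with
  | zero =>
    intro t k l b c hn _ _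
    obtain rfl : k = 0 := by omega
    obtain rfl : l = 0 := by omega
    rfl
  | succ n ih =>
    intro t k l b c hn hb hc
    rcases k with _ | k
    · rcases l with _ | l
      · rfl
      · have h1 := hc.le l (by omega)
        have h2 := hc.lt l (by omega)
        rw [hc.last, ← hb.last, hb.first] at h2
        exact absurd h2 h1.not_gt
    rcases l with _ | l
    · have h1 := hb.le k (by omega)
      have h2 := hb.lt k (by omega)
      rw [hb.last, ← hc.last, hc.first] at h2
      exact absurd h2 h1.not_gt
    rcases lt_trichotomy (b k) (c l) with h | h | h
    · have hct : c l ≤ t := hc.last ▸ (hc.lt l (by omega)).le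
      exact partitionProduct_step T hb hc h
        (ih (c l) (k + 1) l _ c (by omega) (hb.cut h hct) hc.init)
    · have := ih (b k) k l b c (by omega) hb.init (h ▸ hc.init)
      rw [partitionProduct, partitionProduct, this, h, hb.last, hc.last]
    · have hbt : b k ≤ t := hb.last ▸ (hb.lt k (by omega)).le
      exact (partitionProduct_step T hc hb h
        (ih (b k) (l + 1) k _ b (by omega) (hc.cut h hbt) hb.init)).symm

/-- `Φ_d(t, s)` is given by the product formula for every adapted partition of `[s, t]`. -/
theorem evolution_eq (T : Q → C0Semigroup 𝕜 X) (d : SwitchingSignal Q) {t s : ℝ≥0} (h : s ≤ t)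
    {k : ℕ} {b : ℕ → ℝ≥0} (hb : IsSwitchingPartition d.1 s t k b) :
    evolution T d t s h = partitionProduct T d.1 b k :=
  partitionProduct_unique T d.1 s _ t _ k _ b le_rfl (d.2 s t h).choose_spec.choose_spec hb

end Switched

/-!
Along a trajectory a non-coercive Lyapunov function `V` decreases at rate at least `α(ε)` as long
as the state stays outside the ball of radius `ε` (`lyapunov_le_sub_mul`, by the cocycle property
and the continuity of trajectories). As `V ≥ 0` and `V ≤ ψ(r)` on the ball of radius `r`, the state
must enter the `ε`-ball by a time that depends on `ε` and `r` only: `0` is uniformly globally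
weakly attractive.

Under robust forward completeness, linearity turns weak attractivity into exponential stability.
There is a `τ` such that from every state the norm shrinks by the factor `e⁻¹` at some time in
`[0, τ]`, and robust forward completeness bounds the gain on `[0, τ]`; chaining these contractions
gives an exponential bound
(`UniformlyGloballyWeaklyAttractive.exponentiallyStable`). Since exponential stability implies
UGAS, and UGAS implies weak attractivity, UGAS and exponential stability are equivalent.

Conversely, if `‖φ(t, x, d)‖ ≤ M e^{-ωt} ‖x‖`, then `V(x) = sup_{t, d} e^{ωt} ‖φ(t, x, d)‖` is a
Lyapunov function: it satisfies `‖x‖ ≤ V(x) ≤ M ‖x‖`, it is Lipschitz, and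
`V(φ(h, x, d)) ≤ e^{-ωh} V(x)`, because switching signals can be concatenated
(`ExponentiallyStable.exists_isNonCoerciveLyapunov`).
-/

/-! ### Operations on partitions and switching signals -/

section Partitions

variable {Q : Type*} {d d' : ℝ≥0 → Q} {r s t : ℝ≥0} {k l : ℕ} {b c : ℕ → ℝ≥0}

theorem IsSwitchingPartition.le_last (hb : IsSwitchingPartition d s t k b) :
    ∀ j ≤ k, b j ≤ t := by
  intro j hj
  induction hj using Nat.decreasingInduction with
  | self => exact hb.last.le
  | of_succ j hj ih => exact (hb.lt j hj).le.trans ih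

theorem IsSwitchingPartition.congr (hb : IsSwitchingPartition d s t k b)
    (h : Set.EqOn d d' (Set.Ico s t)) : IsSwitchingPartition d' s t k b := by
  refine ⟨hb.first, hb.last, hb.lt, fun j hj τ hτ => ?_⟩
  have h1 := hb.le j hj.le
  have h2 := hb.le_last (j + 1) hj
  rw [← h ⟨h1.trans hτ.1, hτ.2.trans_le h2⟩, ← h ⟨h1, (hb.lt j hj).trans_le h2⟩]
  exact hb.const j hj τ hτ

theorem IsSwitchingPartition.append (hb : IsSwitchingPartition d r s k b)
    (hc : IsSwitchingPartition d s t l c) :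
    IsSwitchingPartition d r t (k + l) (fun j => if j ≤ k then b j else c (j - k)) := by
  have key : ∀ j, k ≤ j → (if j ≤ k then b j else c (j - k)) = c (j - k) := by
    intro j hj
    split_ifs with h
    · obtain rfl : j = k := le_antisymm h hj
      rw [hb.last, Nat.sub_self, hc.first]
    · rfl
  have key' : ∀ j, k ≤ j → (if j + 1 ≤ k then b (j + 1) else c (j + 1 - k)) = c (j - k + 1) := by
    intro j hj
    rw [key (j + 1) (by omega), Nat.sub_add_comm hj]
  refine ⟨by simpa using hb.first, ?_, ?_, ?_⟩
  · rw [key _ (by omega), Nat.add_sub_cancel_left, hc.last]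
  · intro j hj
    rcases lt_or_ge j k with h | h
    · simpa [h.le, Nat.succ_le_of_lt h] using hb.lt j h
    · simp only [key j h, key' j h]
      exact hc.lt (j - k) (by omega)
  · intro j hj τ hτ
    rcases lt_or_ge j k with h | h
    · simp only [h.le, if_true, Nat.succ_le_of_lt h] at hτ ⊢
      exact hb.const j h τ hτ
    · simp only [key j h, key' j h] at hτ ⊢
      exact hc.const (j - k) (by omega) τ hτ

theorem IsSwitchingPartition.translate (hb : IsSwitchingPartition d s t k b) (h : ℝ≥0)
    (hd : ∀ u, d' (u + h) = d u) :
    IsSwitchingPartition d' (s + h) (t + h) k (fun j => b j + h) := by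
  refine ⟨by simp [hb.first], by simp [hb.last], fun j hj => by simpa using hb.lt j hj,
    fun j hj τ hτ => ?_⟩
  obtain ⟨u, rfl⟩ : ∃ u, τ = u + h :=
    ⟨τ - h, (tsub_add_cancel_of_le (le_add_self.trans hτ.1)).symm⟩
  rw [hd, hd]
  exact hb.const j hj u (by simpa using hτ)

theorem IsSwitchingPartition.shift {h : ℝ≥0} (hb : IsSwitchingPartition d (s + h) (t + h) k b) :
    IsSwitchingPartition (fun u => d (u + h)) s t k (fun j => b j - h) := by
  have hle : ∀ j ≤ k, h ≤ b j := fun j hj => le_add_self.trans (hb.le j hj)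
  refine ⟨by simp [hb.first], by simp [hb.last], fun j hj => ?_, fun j hj τ hτ => ?_⟩
  · exact tsub_lt_tsub_right_of_le (hle j hj.le) (hb.lt j hj)
  · simp only [tsub_add_cancel_of_le (hle j hj.le)]
    exact hb.const j hj _ ⟨tsub_le_iff_right.1 hτ.1, lt_tsub_iff_right.1 hτ.2⟩

namespace SwitchingSignal

/-- The signal that takes the value `q` at all times. -/
def const (q : Q) : SwitchingSignal Q := by
  refine ⟨fun _ => q, fun s t hst => ?_⟩
  rcases hst.eq_or_lt with rfl | hlt
  · exact ⟨0, fun _ => s, rfl, rfl, by simp, by simp⟩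
  · refine ⟨1, fun j => if j = 0 then s else t, by simp, by simp, fun j hj => ?_, by simp⟩
    obtain rfl : j = 0 := by omega
    simpa using hlt

instance [Nonempty Q] : Nonempty (SwitchingSignal Q) := ⟨const (Classical.arbitrary Q)⟩

/-- The signal `d` seen from time `h` on, that is `u ↦ d (u + h)`. -/
def shift (h : ℝ≥0) (d : SwitchingSignal Q) : SwitchingSignal Q :=
  ⟨fun u => d.1 (u + h), fun s t hst =>
    let ⟨k, b, hb⟩ := d.2 (s + h) (t + h) (by gcongr)
    ⟨k, fun j => b j - h, hb.shift⟩⟩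

open Classical in
/-- The signal that follows `d` on `[0, h)` and then `d'`, started afresh at time `h`. -/
noncomputable def concat (h : ℝ≥0) (d d' : SwitchingSignal Q) : SwitchingSignal Q := by
  refine ⟨fun u => if u < h then d.1 u else d'.1 (u - h), ?_⟩
  have before : ∀ s t, s ≤ t → t ≤ h → ∃ (k : ℕ) (b : ℕ → ℝ≥0),
      IsSwitchingPartition (fun u => if u < h then d.1 u else d'.1 (u - h)) s t k b := by
    intro s t hst hth
    obtain ⟨k, b, hb⟩ := d.2 s t hst
    exact ⟨k, b, hb.congr fun u hu => by simp [hu.2.trans_le hth]⟩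
  have after : ∀ s t, s ≤ t → h ≤ s → ∃ (k : ℕ) (b : ℕ → ℝ≥0),
      IsSwitchingPartition (fun u => if u < h then d.1 u else d'.1 (u - h)) s t k b := by
    intro s t hst hhs
    obtain ⟨k, b, hb⟩ := d'.2 (s - h) (t - h) (by gcongr)
    have := hb.translate (d' := fun u => if u < h then d.1 u else d'.1 (u - h)) h (by simp)
    rw [tsub_add_cancel_of_le hhs, tsub_add_cancel_of_le (hhs.trans hst)] at this
    exact ⟨k, _, this⟩
  intro s t hst
  rcases le_total t h with h1 | h1
  · exact before s t hst h1
  rcases le_total h s with h2 | h2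
  · exact after s t hst h2
  obtain ⟨k, b, hb⟩ := before s h h2 le_rfl
  obtain ⟨l, c, hc⟩ := after h t h1 le_rfl
  exact ⟨k + l, _, hb.append hc⟩

theorem concat_eqOn (h : ℝ≥0) (d d' : SwitchingSignal Q) :
    Set.EqOn d.1 (concat h d d').1 (Set.Ico 0 h) :=
  fun u hu => by simp [concat, hu.2]

theorem shift_concat (h : ℝ≥0) (d d' : SwitchingSignal Q) : shift h (concat h d d') = d' :=
  Subtype.ext (funext fun u => by simp [concat, shift])

end SwitchingSignal

end Partitions

/-! ### The evolution operators and the flow -/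

section Flow

open SwitchingSignal

variable {𝕜 X Q : Type*} [RCLike 𝕜] [NormedAddCommGroup X] [NormedSpace 𝕜 X]
  (T : Q → C0Semigroup 𝕜 X)

theorem partitionProduct_append (d : ℝ≥0 → Q) {k : ℕ} {b c : ℕ → ℝ≥0} (hbc : b k = c 0) (l : ℕ) :
    partitionProduct T d (fun j => if j ≤ k then b j else c (j - k)) (k + l) =
      partitionProduct T d c l * partitionProduct T d b k := by
  have key : ∀ m, (if k + m ≤ k then b (k + m) else c (k + m - k)) = c m := by
    intro m
    rcases m with _ | m
    · simpa using hbc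
    · simp
  induction l with
  | zero =>
    rw [partitionProduct, one_mul]
    exact partitionProduct_congr T d k fun j hj => by simp [hj]
  | succ l ih =>
    rw [← add_assoc, partitionProduct, ih, partitionProduct, mul_assoc]
    simp only [add_assoc, key]

theorem evolution_mul (d : SwitchingSignal Q) {r s t : ℝ≥0} (h1 : r ≤ s) (h2 : s ≤ t) :
    evolution T d t s h2 * evolution T d s r h1 = evolution T d t r (h1.trans h2) := by
  obtain ⟨k, b, hb⟩ := d.2 r s h1
  obtain ⟨l, c, hc⟩ := d.2 s t h2
  rw [evolution_eq T d h1 hb, evolution_eq T d h2 hc, evolution_eq T d _ (hb.append hc),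
    partitionProduct_append T d.1 (hb.last.trans hc.first.symm)]

theorem evolution_congr {d d' : SwitchingSignal Q} {s t : ℝ≥0} (h : s ≤ t)
    (hd : Set.EqOn d.1 d'.1 (Set.Ico s t)) : evolution T d t s h = evolution T d' t s h := by
  obtain ⟨k, b, hb⟩ := d.2 s t h
  rw [evolution_eq T d h hb, evolution_eq T d' h (hb.congr hd)]
  suffices ∀ j ≤ k, partitionProduct T d.1 b j = partitionProduct T d'.1 b j from this k le_rfl
  intro j hj
  induction j with
  | zero => rfl
  | succ j ih =>
    rw [partitionProduct, partitionProduct, ih (by omega),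
      hd ⟨hb.le j (by omega), (hb.lt j hj).trans_le (hb.le_last _ hj)⟩]

theorem evolution_shift (d : SwitchingSignal Q) (h : ℝ≥0) {s t : ℝ≥0} (hst : s ≤ t) :
    evolution T (shift h d) t s hst = evolution T d (t + h) (s + h) (by gcongr) := by
  obtain ⟨k, b, hb⟩ := (shift h d).2 s t hst
  rw [evolution_eq T _ hst hb,
    evolution_eq T d _ (hb.translate h (d' := d.1) fun u => rfl)]
  clear hb
  induction k with
  | zero => rfl
  | succ k ih =>
    simp only [partitionProduct, ih, add_tsub_add_eq_tsub_right]
    rfl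

theorem switchedFlow_zero (x : X) (d : SwitchingSignal Q) : switchedFlow T 0 x d = x := by
  have : IsSwitchingPartition d.1 0 0 0 (fun _ => 0) := ⟨rfl, rfl, by simp, by simp⟩
  rw [switchedFlow, evolution_eq T d _ this]
  rfl

/-- The cocycle property. -/
theorem switchedFlow_add (t h : ℝ≥0) (x : X) (d : SwitchingSignal Q) :
    switchedFlow T (t + h) x d = switchedFlow T t (switchedFlow T h x d) (shift h d) := by
  have := evolution_mul T d (r := 0) (s := h) (t := t + h) zero_le le_add_self
  rw [switchedFlow, ← this, switchedFlow, switchedFlow, evolution_shift]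
  simp only [zero_add]
  rfl

theorem switchedFlow_concat (t h : ℝ≥0) (x : X) (d d' : SwitchingSignal Q) :
    switchedFlow T (t + h) x (concat h d d') = switchedFlow T t (switchedFlow T h x d) d' := by
  rw [switchedFlow_add, shift_concat]
  congr 1
  rw [switchedFlow, switchedFlow, evolution_congr T _ (concat_eqOn h d d')]

theorem switchedFlow_map_zero (t : ℝ≥0) (d : SwitchingSignal Q) : switchedFlow T t 0 d = 0 :=
  map_zero _

theorem switchedFlow_sub (t : ℝ≥0) (x y : X) (d : SwitchingSignal Q) :
    switchedFlow T t (x - y) d = switchedFlow T t x d - switchedFlow T t y d :=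
  map_sub _ _ _

theorem switchedFlow_smul (t : ℝ≥0) (a : 𝕜) (x : X) (d : SwitchingSignal Q) :
    switchedFlow T t (a • x) d = a • switchedFlow T t x d :=
  map_smul _ _ _

/-- By linearity, a bound at a vector follows from the bound at its normalization. -/
theorem norm_switchedFlow_le_of_normalized {K : ℝ} {t : ℝ≥0} {x : X} {d : SwitchingSignal Q}
    (hx : x ≠ 0) (h : ‖switchedFlow T t (((‖x‖ : 𝕜)⁻¹) • x) d‖ ≤ K) :
    ‖switchedFlow T t x d‖ ≤ K * ‖x‖ := by
  rw [switchedFlow_smul, norm_smul, norm_inv, RCLike.norm_ofReal, abs_norm] at h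
  rwa [inv_mul_le_iff₀ (norm_pos_iff.2 hx), mul_comm] at h

theorem norm_normalized {x : X} (hx : x ≠ 0) : ‖((‖x‖ : 𝕜)⁻¹) • x‖ = 1 :=
  norm_smul_inv_norm hx

/-- Trajectories are continuous: on each interval of a partition adapted to `d` they are orbits of
a single semigroup, and these pieces fit together at the switching times. -/
theorem continuous_switchedFlow (x : X) (d : SwitchingSignal Q) :
    Continuous fun t => switchedFlow T t x d := by
  have key : ∀ (k : ℕ) (t : ℝ≥0) (b : ℕ → ℝ≥0), IsSwitchingPartition d.1 0 t k b →
      ContinuousOn (fun u => switchedFlow T u x d) (Set.Icc 0 t) := by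
    intro k
    induction k with
    | zero =>
      intro t b hb
      obtain rfl : t = 0 := hb.last.symm.trans hb.first
      simp
    | succ k ih =>
      intro t b hb
      have hbt : b k ≤ t := hb.le_last k (by omega)
      have hlast : ContinuousOn (fun u => switchedFlow T u x d) (Set.Icc (b k) t) := by
        have hc : Continuous fun u : ℝ≥0 =>
            (T (d.1 (b k))).op (u - b k) (partitionProduct T d.1 b k x) :=
          ((T (d.1 (b k))).continuous_orbit _).comp (continuous_id.sub continuous_const)
        refine hc.continuousOn.congr fun u hu => ?_
        rcases hu.1.eq_or_lt with rfl | hlt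
        · simp only [switchedFlow]
          rw [evolution_eq T d _ hb.init, tsub_self, (T _).op_zero]
          rfl
        · simp only [switchedFlow]
          rw [evolution_eq T d _ (hb.cut hlt hu.2), partitionProduct, Function.update_self,
            Function.update_of_ne (by omega), partitionProduct_congr T d.1 (c := b) k
              fun j hj => Function.update_of_ne (by omega) _ _]
          rfl
      rw [← Set.Icc_union_Icc_eq_Icc zero_le hbt]
      exact (ih _ b hb.init).union_of_isClosed hlast isClosed_Icc isClosed_Icc
  -- A partition of `[0, t + 1)` makes `t` an interior point, in `ℝ≥0`, of the interval covered.
  refine continuous_iff_continuousAt.2 fun t => ?_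
  obtain ⟨k, b, hb⟩ := d.2 0 (t + 1) zero_le
  refine (key k _ b hb).continuousAt ?_
  rw [← bot_eq_zero, Set.Icc_bot]
  exact Iic_mem_nhds (lt_add_one t)

end Flow

/-! ### Lyapunov functions and stability -/

section Lyapunov

open SwitchingSignal

variable {𝕜 X Q : Type*} [RCLike 𝕜] [NormedAddCommGroup X] [NormedSpace 𝕜 X]
  {T : Q → C0Semigroup 𝕜 X}

/-- If the Dini derivative of `V` is at most `-c` at every point of a trajectory on `[0, τ)`, then
`V` has decreased by at least `c τ` at time `τ`. -/
theorem lyapunov_le_sub_mul {V : X → ℝ≥0} (hV : Continuous V) {x : X} {d : SwitchingSignal Q}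
    {τ : ℝ≥0} {c : ℝ}
    (h : ∀ t < τ, diniDeriv (switchedFlow T) V (switchedFlow T t x d) (shift t d) ≤
      ((-c : ℝ) : EReal)) :
    (V (switchedFlow T τ x d) : ℝ) ≤ V x - c * τ := by
  set f : ℝ → ℝ := fun t => V (switchedFlow T t.toNNReal x d) with hf
  have hfc : Continuous f := NNReal.continuous_coe.comp
    (hV.comp ((continuous_switchedFlow T x d).comp continuous_real_toNNReal))
  have key := image_le_of_liminf_slope_right_le_deriv_boundary (f := f) (a := 0) (b := τ)
    hfc.continuousOn (B := fun t => V x - c * t) (B' := fun _ => -c)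
    (by simp [hf, switchedFlow_zero]) (by fun_prop)
    (fun t _ => by simpa using (((hasDerivAt_id t).const_mul c).const_sub (V x : ℝ)).hasDerivWithinAt)
    ?_ (x := τ) ⟨τ.2, le_rfl⟩
  · simpa [hf] using key
  intro t ht r hr
  lift t to ℝ≥0 using ht.1
  have hlt := (h t (by exact_mod_cast ht.2)).trans_lt (EReal.coe_lt_coe_iff.2 hr)
  have hfreq := frequently_lt_of_liminf_lt (h := hlt)
  have htend : Tendsto (fun u : ℝ≥0 => ((u + t : ℝ≥0) : ℝ)) (𝓝[>] 0) (𝓝[>] (t : ℝ)) := by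
    refine tendsto_nhdsWithin_iff.2 ⟨?_, ?_⟩
    · have : Continuous fun u : ℝ≥0 => ((u + t : ℝ≥0) : ℝ) := by fun_prop
      simpa using (this.tendsto 0).mono_left nhdsWithin_le_nhds
    · filter_upwards [self_mem_nhdsWithin] with u hu
      simpa using hu
  refine htend.frequently (hfreq.mono fun u hu => ?_)
  rw [EReal.coe_lt_coe_iff, ← switchedFlow_add] at hu
  rw [slope_def_field]
  simp only [hf, Real.toNNReal_coe]
  rwa [NNReal.coe_add, add_sub_cancel_right]

theorem IsNonCoerciveLyapunov.uniformlyGloballyWeaklyAttractive {V : X → ℝ≥0}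
    (hV : IsNonCoerciveLyapunov (switchedFlow T) V) :
    UniformlyGloballyWeaklyAttractive (switchedFlow T) := by
  obtain ⟨hcont, hV0, ⟨ψ, hψ, hVψ⟩, α, hα, hdini⟩ := hV
  intro ε hε r hr
  lift ε to ℝ≥0 using hε.le
  lift r to ℝ≥0 using hr.le
  have hαε : 0 < α ε := hα.map_zero ▸ hα.strictMono (by exact_mod_cast hε)
  -- A decrease of `V` at rate `α ε` during this time would exceed its initial value, at most `ψ r`.
  refine ⟨(ψ r + 1) / α ε, fun x d hx => ?_⟩
  by_contra! hcon
  have hle := lyapunov_le_sub_mul (T := T) hcont (x := x) (d := d) (τ := (ψ r + 1) / α ε)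
    (c := α ε) fun t ht => (hdini _ _).trans <| by
      rw [EReal.coe_le_coe_iff, neg_le_neg_iff]
      exact_mod_cast hα.strictMono.monotone (by exact_mod_cast (hcon t ht.le).le)
  have hVx : V x ≤ ψ r := by
    rcases eq_or_ne x 0 with rfl | hx0
    · simp [hV0]
    · exact (hVψ x hx0).2.trans (hψ.strictMono.monotone (by exact_mod_cast hx))
  have hVx' : (V x : ℝ) ≤ ψ r := by exact_mod_cast hVx
  have hαε' : (α ε : ℝ) ≠ 0 := by exact_mod_cast hαε.ne'
  push_cast at hle
  rw [mul_div_cancel₀ _ hαε'] at hle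
  have := (V (switchedFlow T ((ψ r + 1) / α ε) x d)).2
  simp only [NNReal.val_eq_coe] at this
  linarith

/-- By linearity, robust forward completeness is a uniform bound on the operator norms of the
flow on bounded time intervals. -/
theorem RobustlyForwardComplete.exists_gain (hT : RobustlyForwardComplete (switchedFlow T))
    (τ : ℝ≥0) : ∃ K : ℝ, 1 ≤ K ∧ ∀ (x : X) (d : SwitchingSignal Q), ∀ t ≤ τ,
      ‖switchedFlow T t x d‖ ≤ K * ‖x‖ := by
  obtain ⟨K, hK⟩ := hT 1 one_pos (τ + 1) (by positivity)
  refine ⟨max K 1, le_max_right _ _, fun x d t ht => ?_⟩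
  rcases eq_or_ne x 0 with rfl | hx
  · simp [switchedFlow_map_zero]
  refine norm_switchedFlow_le_of_normalized T hx (le_max_of_le_left (hK ?_))
  exact ⟨t, _, d, (norm_normalized hx).le, ht.trans le_self_add, rfl⟩

/-- For a robustly forward complete linear flow, weak attractivity is already exponential
stability: the uniform contractions it provides can be chained, and the gain between two of them
is bounded. -/
theorem UniformlyGloballyWeaklyAttractive.exponentiallyStable
    (hT : RobustlyForwardComplete (switchedFlow T))
    (hW : UniformlyGloballyWeaklyAttractive (switchedFlow T)) :
    ExponentiallyStable (switchedFlow T) := by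
  obtain ⟨τ₀, hτ₀⟩ := hW (Real.exp (-1)) (Real.exp_pos _) 1 one_pos
  -- Enlarging the hitting time makes it positive.
  set τ : ℝ≥0 := τ₀ + 1 with hτdef
  have hτ : (0 : ℝ) < τ := by positivity
  have hhit : ∀ (x : X) (d : SwitchingSignal Q), ∃ t ≤ τ,
      ‖switchedFlow T t x d‖ ≤ Real.exp (-1) * ‖x‖ := by
    intro x d
    rcases eq_or_ne x 0 with rfl | hx
    · exact ⟨0, zero_le, by simp [switchedFlow_map_zero]⟩
    obtain ⟨t, ht, h⟩ := hτ₀ (((‖x‖ : 𝕜)⁻¹) • x) d (norm_normalized hx).le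
    exact ⟨t, ht.trans le_self_add, norm_switchedFlow_le_of_normalized T hx h⟩
  obtain ⟨K, hK1, hK⟩ := hT.exists_gain τ
  have hK0 : 0 < K := one_pos.trans_le hK1
  -- With `n` the number of contractions up to time `t`, one has `t ≤ (n + 1) τ`; hence the rate
  -- `1 / τ`, and the factor `e` for the last, incomplete step.
  refine ⟨K * Real.exp 1, 1 / τ, ?_, by positivity, fun x d t => ?_⟩
  · exact one_le_mul_of_one_le_of_one_le hK1 (Real.one_le_exp zero_le_one)
  by_cases hall : ∀ n : ℕ, ∃ s ≤ t, s ≤ n * τ ∧ ‖switchedFlow T s x d‖ ≤ Real.exp (-n) * ‖x‖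
  · -- Arbitrarily many contractions happen before time `t`; as the gain on `[0, t]` is finite,
    -- the state at time `t` vanishes.
    obtain ⟨L, hL1, hL⟩ := hT.exists_gain t
    have hle : ∀ n : ℕ, ‖switchedFlow T t x d‖ ≤ L * (Real.exp (-n) * ‖x‖) := by
      intro n
      obtain ⟨s, hst, -, hs⟩ := hall n
      have := hL (switchedFlow T s x d) (shift s d) (t - s) tsub_le_self
      rw [← switchedFlow_add, tsub_add_cancel_of_le hst] at this
      exact this.trans (by gcongr)
    have hlim : Tendsto (fun n : ℕ => L * (Real.exp (-n) * ‖x‖)) atTop (𝓝 (L * (0 * ‖x‖))) :=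
      ((Real.tendsto_exp_neg_atTop_nhds_zero.comp tendsto_natCast_atTop_atTop).mul_const _).const_mul _
    have := ge_of_tendsto' hlim hle
    rw [zero_mul, mul_zero] at this
    exact this.trans (by positivity)
  · -- Otherwise consider the last contraction before time `t`.
    have hex : ∃ n : ℕ, (∃ s ≤ t, s ≤ n * τ ∧ ‖switchedFlow T s x d‖ ≤ Real.exp (-n) * ‖x‖) ∧
        ¬ ∃ s ≤ t, s ≤ (n + 1 : ℕ) * τ ∧
          ‖switchedFlow T s x d‖ ≤ Real.exp (-(n + 1 : ℕ)) * ‖x‖ := by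
      by_contra! hcon
      refine hall fun n => ?_
      induction n with
      | zero => exact ⟨0, zero_le, by simp, by simp [switchedFlow_zero]⟩
      | succ n ih => exact hcon n ih
    obtain ⟨n, ⟨s, hst, hsn, hs⟩, hn⟩ := hex
    obtain ⟨u, hu, hux⟩ := hhit (switchedFlow T s x d) (shift s d)
    rw [← switchedFlow_add] at hux
    have hlt : t < u + s := by
      by_contra! hle
      refine hn ⟨u + s, hle, ?_, hux.trans ?_⟩
      · push_cast
        rw [add_mul, one_mul, add_comm]
        gcongr
      · push_cast
        rw [neg_add_rev, Real.exp_add, mul_assoc]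
        gcongr
    have htn : (t : ℝ) ≤ (n + 1) * τ := by
      have : t ≤ (n + 1) * τ := by
        rw [add_mul, one_mul, add_comm]
        exact hlt.le.trans (by gcongr)
      exact_mod_cast this
    have hbound := hK (switchedFlow T s x d) (shift s d) (t - s)
      (tsub_le_iff_right.2 (hlt.le.trans (by gcongr)))
    rw [← switchedFlow_add, tsub_add_cancel_of_le hst] at hbound
    have hexp : Real.exp (-n) ≤ Real.exp 1 * Real.exp (-(1 / τ) * t) := by
      rw [← Real.exp_add, Real.exp_le_exp]
      have : (t : ℝ) / τ ≤ n + 1 := (div_le_iff₀ hτ).2 htn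
      have h2 : -(1 / (τ : ℝ)) * t = -(t / τ) := by ring
      rw [h2]
      linarith
    calc ‖switchedFlow T t x d‖ ≤ K * ‖switchedFlow T s x d‖ := hbound
      _ ≤ K * (Real.exp (-n) * ‖x‖) := by gcongr
      _ ≤ K * (Real.exp 1 * Real.exp (-(1 / τ) * t) * ‖x‖) := by gcongr
      _ = K * Real.exp 1 * Real.exp (-(1 / τ) * t) * ‖x‖ := by ring

theorem UGAS.uniformlyGloballyWeaklyAttractive {X 𝒟 : Type*} [NormedAddCommGroup X]
    {φ : ℝ≥0 → X → 𝒟 → X} (h : UGAS φ) : UniformlyGloballyWeaklyAttractive φ := by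
  obtain ⟨β, hβ, hφ⟩ := h
  intro ε hε r hr
  lift ε to ℝ≥0 using hε.le
  lift r to ℝ≥0 using hr.le
  obtain ⟨τ, hτ⟩ := ((hβ.classL r (by exact_mod_cast hr)).tendsto_zero.eventually
    (Iic_mem_nhds (show 0 < ε by exact_mod_cast hε))).exists
  refine ⟨τ, fun x d hx => ⟨τ, le_rfl, (hφ x d τ).trans ?_⟩⟩
  exact_mod_cast ((hβ.classK τ).strictMono.monotone (by exact_mod_cast hx)).trans hτ

theorem ExponentiallyStable.ugas {X 𝒟 : Type*} [NormedAddCommGroup X]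
    {φ : ℝ≥0 → X → 𝒟 → X} (h : ExponentiallyStable φ) : UGAS φ := by
  obtain ⟨M, ω, hM, hω, hφ⟩ := h
  have hM0 : 0 < M := one_pos.trans_le hM
  have hpos : ∀ t : ℝ≥0, 0 < (M * Real.exp (-ω * t)).toNNReal := fun t =>
    Real.toNNReal_pos.2 (by positivity)
  refine ⟨fun r t => (M * Real.exp (-ω * t)).toNNReal * r, ⟨fun t => ⟨by fun_prop, fun a b hab => ?_,
    by simp⟩, fun r hr => ⟨?_, fun a b hab => ?_, ?_⟩⟩, fun x d t => ?_⟩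
  · exact mul_lt_mul_of_pos_left hab (hpos t)
  · have : Continuous fun t : ℝ≥0 => M * Real.exp (-ω * t) := by fun_prop
    exact (continuous_real_toNNReal.comp this).mul continuous_const
  · have : (a : ℝ) ≤ b := hab
    simp only [neg_mul]
    gcongr
  · have h1 : Tendsto (fun t : ℝ≥0 => ω * (t : ℝ)) atTop atTop :=
      (NNReal.tendsto_coe_atTop.2 tendsto_id).const_mul_atTop hω
    have h2 := (Real.tendsto_exp_neg_atTop_nhds_zero.comp h1).const_mul M
    have h3 := ((continuous_real_toNNReal.tendsto _).comp h2).mul_const r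
    simpa [Function.comp_def] using h3
  · have : (0 : ℝ) ≤ M * Real.exp (-ω * t) := by positivity
    rw [NNReal.coe_mul, Real.coe_toNNReal _ this]
    exact hφ x d t

/-- The converse Lyapunov theorem, with `V(x) = sup_{t, d} e^{ωt} ‖φ(t, x, d)‖`. -/
theorem ExponentiallyStable.exists_isNonCoerciveLyapunov [Nonempty Q]
    (h : ExponentiallyStable (switchedFlow T)) :
    ∃ V : X → ℝ≥0, IsNonCoerciveLyapunov (switchedFlow T) V := by
  obtain ⟨M, ω, hM, hω, hφ⟩ := h
  have hM0 : 0 < M := one_pos.trans_le hM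
  let g : X → ℝ≥0 × SwitchingSignal Q → ℝ := fun x p =>
    Real.exp (ω * p.1) * ‖switchedFlow T p.1 x p.2‖
  have hgM : ∀ x p, g x p ≤ M * ‖x‖ := by
    intro x p
    calc g x p ≤ Real.exp (ω * p.1) * (M * Real.exp (-ω * p.1) * ‖x‖) :=
          mul_le_mul_of_nonneg_left (hφ x p.2 p.1) (Real.exp_pos _).le
      _ = Real.exp (ω * p.1) * Real.exp (-(ω * p.1)) * (M * ‖x‖) := by rw [neg_mul]; ring
      _ = M * ‖x‖ := by rw [← Real.exp_add, add_neg_cancel, Real.exp_zero, one_mul]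
  have hbdd : ∀ x, BddAbove (Set.range (g x)) := fun x =>
    ⟨M * ‖x‖, Set.forall_mem_range.2 (hgM x)⟩
  let W : X → ℝ := fun x => ⨆ p, g x p
  have hW0 : ∀ x, 0 ≤ W x := fun x => Real.iSup_nonneg fun p => by positivity
  have hWM : ∀ x, W x ≤ M * ‖x‖ := fun x => ciSup_le (hgM x)
  have hle : ∀ x, ‖x‖ ≤ W x := by
    intro x
    obtain ⟨d⟩ : Nonempty (SwitchingSignal Q) := inferInstance
    simpa [g, switchedFlow_zero] using le_ciSup (hbdd x) (0, d)
  have hWc : Continuous W := by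
    refine (LipschitzWith.of_le_add_mul M.toNNReal fun x y => ciSup_le fun p => ?_).continuous
    rw [Real.coe_toNNReal _ hM0.le, dist_eq_norm]
    calc g x p ≤ g y p + g (x - y) p := by
          simp only [g, switchedFlow_sub, ← mul_add]
          gcongr
          exact norm_le_norm_add_norm_sub' _ _
      _ ≤ W y + M * ‖x - y‖ := add_le_add (le_ciSup (hbdd y) p) (hgM _ p)
  -- Concatenation of signals turns the supremum at `φ(h, x, d)` into one over a subfamily of
  -- the trajectories that start at `x`.
  have hdecay : ∀ x d (h : ℝ≥0), W (switchedFlow T h x d) ≤ Real.exp (-(ω * h)) * W x := by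
    intro x d h
    refine ciSup_le fun p => ?_
    calc g (switchedFlow T h x d) p
        = Real.exp (-(ω * h)) * g x (p.1 + h, concat h d p.2) := by
          simp only [g, switchedFlow_concat]
          rw [← mul_assoc, ← Real.exp_add]
          congr 2
          push_cast
          ring
      _ ≤ Real.exp (-(ω * h)) * W x := by
          gcongr
          exact le_ciSup (hbdd x) _
  obtain ⟨V, hV⟩ : ∃ V : X → ℝ≥0, ∀ x, (V x : ℝ) = W x := ⟨fun x => ⟨W x, hW0 x⟩, fun _ => rfl⟩
  have hVc : Continuous V := continuous_induced_rng.2 (hWc.congr fun x => (hV x).symm)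
  refine ⟨V, hVc, ?_, ⟨fun r => M.toNNReal * r, ?_, ?_⟩,
    fun r => ω.toNNReal * r, ?_, fun x d => ?_⟩
  · exact NNReal.eq ((hV 0).trans (le_antisymm (by simpa using hWM 0) (hW0 0)))
  · have hM' : 0 < M.toNNReal := Real.toNNReal_pos.2 hM0
    refine ⟨⟨by fun_prop, fun a b hab => mul_lt_mul_of_pos_left hab hM', by simp⟩, ?_⟩
    rintro ⟨c, hc⟩
    have := hc ⟨(c + 1) / M.toNNReal, rfl⟩
    simp only [mul_div_cancel₀ _ hM'.ne'] at this
    exact (lt_add_one c).not_ge this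
  · intro x hx
    rw [← NNReal.coe_pos, ← NNReal.coe_le_coe, hV, NNReal.coe_mul, Real.coe_toNNReal _ hM0.le]
    exact ⟨(norm_pos_iff.2 hx).trans_le (hle x), hWM x⟩
  · exact ⟨by fun_prop, fun a b hab => mul_lt_mul_of_pos_left hab (Real.toNNReal_pos.2 hω),
      by simp⟩
  · have hderiv : HasDerivAt (fun u : ℝ => Real.exp (-(ω * u)) * W x) (-ω * W x) 0 := by
      simpa using ((((hasDerivAt_id (0 : ℝ)).const_mul ω).neg).exp).mul_const (W x)
    have hcoe : Tendsto (fun u : ℝ≥0 => (u : ℝ)) (𝓝[>] 0) (𝓝[≠] 0) := by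
      refine tendsto_nhdsWithin_iff.2 ⟨?_, ?_⟩
      · simpa using (NNReal.continuous_coe.tendsto 0).mono_left nhdsWithin_le_nhds
      · filter_upwards [self_mem_nhdsWithin] with u hu
        simpa using (show (0 : ℝ≥0) < u from hu).ne'
    have hlim := (continuous_coe_real_ereal.tendsto _).comp
      ((hasDerivAt_iff_tendsto_slope.1 hderiv).comp hcoe)
    calc diniDeriv (switchedFlow T) V x d
        ≤ ((-ω * W x : ℝ) : EReal) := by
          rw [← hlim.liminf_eq]
          refine liminf_le_liminf (Eventually.of_forall fun u => ?_)
          simp only [Function.comp_apply, slope_def_field, EReal.coe_le_coe_iff, sub_zero,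
            mul_zero, neg_zero, Real.exp_zero, one_mul, hV]
          gcongr
          exact hdecay x d u
      _ ≤ _ := by
          rw [EReal.coe_le_coe_iff]
          simp only [NNReal.coe_mul, coe_nnnorm, Real.coe_toNNReal _ hω.le]
          nlinarith [hle x]

end Lyapunov

theorem corollaryc {𝕜 X Q : Type*} [RCLike 𝕜] [NormedAddCommGroup X] [NormedSpace 𝕜 X]
    [CompleteSpace X] [Nonempty Q]
    (A : Q → X →ₗ.[𝕜] X) (T : Q → C0Semigroup 𝕜 X) (hA : ∀ q, (T q).IsGenerator (A q)) :
    ((∃ V : X → ℝ≥0, IsNonCoerciveLyapunov (switchedFlow T) V) →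
      UniformlyGloballyWeaklyAttractive (switchedFlow T)) ∧
    (RobustlyForwardComplete (switchedFlow T) →
      ((∃ V : X → ℝ≥0, IsNonCoerciveLyapunov (switchedFlow T) V) ↔ UGAS (switchedFlow T)) ∧
      (UGAS (switchedFlow T) ↔ ExponentiallyStable (switchedFlow T))) := by
  refine ⟨fun ⟨V, hV⟩ => hV.uniformlyGloballyWeaklyAttractive, fun hT => ?_⟩
  have hexp : UGAS (switchedFlow T) → ExponentiallyStable (switchedFlow T) := fun h =>
    h.uniformlyGloballyWeaklyAttractive.exponentiallyStable hT
  exact ⟨⟨fun ⟨V, hV⟩ => (hV.uniformlyGloballyWeaklyAttractive.exponentiallyStable hT).ugas,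
    fun h => (hexp h).exists_isNonCoerciveLyapunov⟩, hexp, ExponentiallyStable.ugas⟩
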